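/- **Theorem (Finite activity identification).** Let $R:\mathbb{R}^n\to\mathbb{R}\cup\{+\infty\}$ be proper, lower semicontinuous (lsc) and bounded from below, and let $F:\mathbb{R}^n\to\mathbb{R}$ be differentiable with $L$-Lipschitz continuous gradient. Assume that $\Phi=R+F$ is a proper lsc Kurdyka–Łojasiewicz (KL) function that is bounded from below. *Subdifferentials.* For $J:\mathbb{R}^n\to\mathbb{R}\cup\{+\infty\}$ and $x$ with $J(x)<+\infty$, the Fréchet subdifferential $\partial^F J(x)$ is the set of $v$ with $\liminf_{z\to x,\,z\ne x}\frac{J(z)-J(x)-\langle v,z-x\rangle}{\|x-z\|}\ge 0$, and $\partial J(x)$ is the set of all limits $v=\lim v_k$ with $v_k\in\partial^F J(u_k)$, $u_k\to x$, $J(u_k)\to J(x)$; both are empty if $J(x)=+\infty$. We put $\operatorname{crit}(J)=\{x: 0\in\partial J(x)\}$. A proper lsc $J$ is a KL function if at every $\bar x$ with $\partial J(\bar x)\neq\emptyset$ there are $\eta\in\,]0,+\infty]$, a neighbourhood $U$ of $\bar x$ and a continuous concave $\varphi:[0,\eta[\,\to[0,+\infty[$ with $\varphi(0)=0$, $\varphi$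 being $C^1$ with $\varphi'>0$ on $]0,\eta[$, such that $\varphi'(J(x)-J(\bar x))\operatorname{dist}(0,\partial J(x))\ge 1$ for all $x\in U$ with $J(\bar x)<J(x)<J(\bar x)+\eta$ (where $\operatorname{dist}(0,\emptyset)=+\infty$). *Algorithm (MiFB).* Let $s\ge1$ be an integer, $I=\{0,\dots,s-1\}$, $x_0\in\mathbb{R}^n$, $x_{-s}=\dots=x_{-1}=x_0$, and let $0<\underline\gamma\le\gamma_k\le\overline\gamma<1/L$ and $a_{i,k},b_{i,k}\in\,]-1,2]$ (with $1/0=+\infty$). For all $k\in\mathbb{N}$ let $$y_{a,k}=x_k+\sum_{i\in I}a_{i,k}(x_{k-i}-x_{k-i-1}),\quad y_{b,k}=x_k+\sum_{i\in I}b_{i,k}(x_{k-i}-x_{k-i-1}),$$ $$x_{k+1}\in\operatorname*{Argmin}_{u\in\mathbb{R}^n}\ \tfrac12\|u-(y_{a,k}-\gamma_k\nabla F(y_{b,k}))\|^2+\gamma_kR(u).$$ Assume that for some $\mu,\nu>0$ $$\liminf_{k}\frac{1-\gamma_kL-\mu-\nu\gamma_k}{2\gamma_k}-\sum_{i\in I}\limsup_{k}\Big(\frac{s\,a_{i,k}^2}{2\gamma_k\mu}+\frac{s\,b_{i,k}^2L^2}{2\nu}\Big)>0,$$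 and that $x_k$ converges to some $x^\star\in\operatorname{crit}(\Phi)$. *Partial smoothness.* Let $\mathcal{M}_{x^\star}\subset\mathbb{R}^n$ and assume that $R$ is $C^2$-partly smooth at $x^\star\in\mathcal{M}_{x^\star}$ relative to $\mathcal{M}_{x^\star}$ for $\bar v=-\nabla F(x^\star)\in\partial R(x^\star)$, that is: $\mathcal{M}_{x^\star}$ is a $C^2$-submanifold of $\mathbb{R}^n$ around $x^\star$ with tangent space $\mathcal{T}$ at $x^\star$, and 1. (smoothness) $R$ restricted to $\mathcal{M}_{x^\star}$ is $C^2$ around $x^\star$; 2. (regularity) $\partial^FR(x)=\partial R(x)$ for all $x\in\mathcal{M}_{x^\star}$ near $x^\star$, and $R$ is prox-regular at $x^\star$ for $\bar v$: there is $r>0$ such that $R(x')\ge R(x)+\langle v,x'-x\rangle-\frac1{2r}\|x-x'\|^2$ for all $x,x'$ near $x^\star$ with $R(x)$ near $R(x^\star)$ and all $v\in\partial R(x)$ near $\bar v$; 3. (sharpness) $\mathcal{T}$ is the orthogonal complement of the subspace parallel to $\partial R(x^\star)$; 4. (continuity) $\partial R$ is continuous (outer and inner semicontinuous) at $x^\star$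 relative to $\mathcal{M}_{x^\star}$. Assume moreover the non-degeneracy condition $-\nabla F(x^\star)\in\operatorname{ri}(\partial R(x^\star))$, where $\operatorname{ri}$ is the relative interior. Then $x_k\in\mathcal{M}_{x^\star}$ for all $k$ large enough. -/

import Mathlib

open Filter Topology

noncomputable section

namespace MiFB

section VariationalAnalysis

variable {E : Type*} [NormedAddCommGroup E] [InnerProductSpace ℝ E]

/-- The effective domain `{x | J x < +∞}`. -/
def dom (J : E → EReal) : Set E := {x | J x < ⊤}

/-- `J` takes values in `ℝ ∪ {+∞}` and is not identically `+∞`. -/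
def IsProper (J : E → EReal) : Prop := (∀ x, J x ≠ ⊥) ∧ (dom J).Nonempty

/-- `J` is bounded from below by a real number. -/
def IsBoundedBelow (J : E → EReal) : Prop := ∃ m : ℝ, ∀ x, (m : EReal) ≤ J x

/-- The Fréchet subdifferential of `J` at `x` (empty outside the domain):
`v` with `liminf_{z → x, z ≠ x} (J z - J x - ⟨v, z - x⟩) / ‖x - z‖ ≥ 0`. -/
def frechetSubdiff (J : E → EReal) (x : E) : Set E :=
  {v | x ∈ dom J ∧
    0 ≤ liminf (fun z => (J z - J x - ((inner ℝ v (z - x) : ℝ) : EReal)) / ((‖x - z‖ : ℝ) : EReal))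
      (𝓝[≠] x)}

/-- The limiting subdifferential of `J` at `x` (empty outside the domain). -/
def subdiff (J : E → EReal) (x : E) : Set E :=
  {v | x ∈ dom J ∧ ∃ (u : ℕ → E) (w : ℕ → E),
    Tendsto u atTop (𝓝 x) ∧ Tendsto (fun k => J (u k)) atTop (𝓝 (J x)) ∧
    (∀ k, w k ∈ frechetSubdiff J (u k)) ∧ Tendsto w atTop (𝓝 v)}

/-- The critical points of `J`. -/
def crit (J : E → EReal) : Set E := {x | 0 ∈ subdiff J x}

/-- (Subdifferential) regularity: the Fréchet and the limiting subdifferentials coincide. -/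
def IsRegularAt (J : E → EReal) (x : E) : Prop := frechetSubdiff J x = subdiff J x

/-- Prox-regularity of `J` at `x₀` for `v₀ ∈ ∂J(x₀)`: for some `r > 0`,
`J x' ≥ J x + ⟨v, x' - x⟩ - ‖x - x'‖² / (2r)` for all `x, x'` near `x₀` with `J x` near `J x₀`
and all `v ∈ ∂J(x)` near `v₀`. The values `J x` and `J x₀` are finite here for proper `J`. -/
def IsProxRegularAt (J : E → EReal) (x₀ v₀ : E) : Prop :=
  v₀ ∈ subdiff J x₀ ∧ ∃ r : ℝ, 0 < r ∧ ∃ ε : ℝ, 0 < ε ∧ ∀ x x' v : E,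
    ‖x - x₀‖ < ε → ‖x' - x₀‖ < ε → |(J x).toReal - (J x₀).toReal| < ε →
    v ∈ subdiff J x → ‖v - v₀‖ < ε →
    J x + ((inner ℝ v (x' - x) - 1 / (2 * r) * ‖x - x'‖ ^ 2 : ℝ) : EReal) ≤ J x'

/-- The Kurdyka–Łojasiewicz property of `J` at `x₀`. The desingularizing function `φ` only matters
on `[0, η[`, where `η ∈ ]0, +∞]`; `dist(0, ∅) = +∞`. -/
def HasKLPropertyAt (J : E → EReal) (x₀ : E) : Prop :=
  x₀ ∈ dom J ∧ ∃ η : EReal, 0 < η ∧ ∃ U ∈ 𝓝 x₀, ∃ φ : ℝ → ℝ,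
    ContinuousOn φ {t : ℝ | 0 ≤ t ∧ (t : EReal) < η} ∧
    ConcaveOn ℝ {t : ℝ | 0 ≤ t ∧ (t : EReal) < η} φ ∧
    (∀ t : ℝ, 0 ≤ t → (t : EReal) < η → 0 ≤ φ t) ∧
    φ 0 = 0 ∧
    ContDiffOn ℝ 1 φ {t : ℝ | 0 < t ∧ (t : EReal) < η} ∧
    (∀ t : ℝ, 0 < t → (t : EReal) < η → 0 < deriv φ t) ∧
    ∀ x ∈ U, J x₀ < J x → J x < J x₀ + η →
      1 ≤ ENNReal.ofReal (deriv φ ((J x).toReal - (J x₀).toReal)) *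
        Metric.infEDist 0 (subdiff J x)

/-- `J` is a KL function: proper, lsc, with the KL property at each point of `dom ∂J`. -/
def IsKLFunction (J : E → EReal) : Prop :=
  IsProper J ∧ LowerSemicontinuous J ∧ ∀ x, (subdiff J x).Nonempty → HasKLPropertyAt J x

/-- The set-valued proximity operator `prox_{γJ}(z) = Argmin_u ½‖u - z‖² + γ J u`. -/
def prox (γ : ℝ) (J : E → EReal) (z : E) : Set E :=
  {p | ∀ u : E, ((1 / 2 * ‖p - z‖ ^ 2 : ℝ) : EReal) + (γ : EReal) * J p ≤
    ((1 / 2 * ‖u - z‖ ^ 2 : ℝ) : EReal) + (γ : EReal) * J u}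

/-- `M` is a `C²` embedded submanifold around `x₀ ∈ M`: near `x₀` it is the zero set of a
`C²` submersion. -/
def IsC2SubmanifoldAround (M : Set E) (x₀ : E) : Prop :=
  x₀ ∈ M ∧ ∃ (m : ℕ) (G : E → EuclideanSpace ℝ (Fin m)) (U : Set E),
    IsOpen U ∧ x₀ ∈ U ∧ ContDiffOn ℝ 2 G U ∧
    (∀ y ∈ U, Function.Surjective (fderiv ℝ G y)) ∧ M ∩ U = {y ∈ U | G y = 0}

/-- The tangent space of `M` at `x₀`: the velocities at `x₀` of the `C¹` curves in `M`
through `x₀`. -/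
def tangentSpaceAt (M : Set E) (x₀ : E) : Set E :=
  {h | ∃ c : ℝ → E, ContDiffAt ℝ 1 c 0 ∧ c 0 = x₀ ∧ (∀ᶠ t in 𝓝 (0 : ℝ), c t ∈ M) ∧
    deriv c 0 = h}

/-- Continuity (in the Painlevé–Kuratowski sense) of a set-valued map `S` at `x₀` relative to `M`:
outer semicontinuity and inner semicontinuity. -/
def IsContinuousAtRel (S : E → Set E) (M : Set E) (x₀ : E) : Prop :=
  (∀ (u w : ℕ → E) (v : E), (∀ k, u k ∈ M) → Tendsto u atTop (𝓝 x₀) →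
    (∀ k, w k ∈ S (u k)) → Tendsto w atTop (𝓝 v) → v ∈ S x₀) ∧
  (∀ v ∈ S x₀, ∀ ε : ℝ, 0 < ε → ∀ᶠ x in 𝓝[M] x₀, ∃ w ∈ S x, ‖w - v‖ < ε)

/-- `J` is `C²`-partly smooth at `x₀` relative to `M` for `v₀ ∈ ∂J(x₀)`. -/
structure IsPartlySmoothAt (J : E → EReal) (x₀ v₀ : E) (M : Set E) : Prop where
  mem_subdiff : v₀ ∈ subdiff J x₀
  submanifold : IsC2SubmanifoldAround M x₀
  /-- `J` restricted to `M` has a `C²` representative around `x₀`. -/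
  smoothness : ∃ g : E → ℝ, ContDiffAt ℝ 2 g x₀ ∧ ∀ᶠ x in 𝓝[M] x₀, J x = (g x : EReal)
  regularity : ∀ᶠ x in 𝓝[M] x₀, IsRegularAt J x
  proxRegularity : IsProxRegularAt J x₀ v₀
  /-- `T_M(x₀) = par(∂J(x₀))^⊥`; the subspace parallel to a convex set `Ω` is the linear span of
  `Ω - Ω`. -/
  sharpness : tangentSpaceAt M x₀ = ((vectorSpan ℝ (subdiff J x₀))ᗮ : Submodule ℝ E)
  continuity : IsContinuousAtRel (subdiff J) M x₀

end VariationalAnalysis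

section Algorithm

variable {n : ℕ}

/-- The objective `Φ = R + F`. -/
def objective (R : EuclideanSpace ℝ (Fin n) → EReal) (F : EuclideanSpace ℝ (Fin n) → ℝ) :
    EuclideanSpace ℝ (Fin n) → EReal :=
  fun x => R x + (F x : EReal)

/-- The extrapolated point `x_k + ∑_{i < s} c_i (x_{k-i} - x_{k-i-1})`. The convention
`x_{-s} = ⋯ = x_{-1} = x_0` is exactly the truncation of natural number subtraction. -/
def extrapolate {s : ℕ} (x : ℕ → EuclideanSpace ℝ (Fin n)) (c : Fin s → ℝ) (k : ℕ) :
    EuclideanSpace ℝ (Fin n) :=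
  x k + ∑ i : Fin s, c i • (x (k - (i : ℕ)) - x (k - (i : ℕ) - 1))

/-- `x` is a sequence generated by the `s`-step inertial Forward–Backward algorithm for `R + F`,
where `∇F` is `L`-Lipschitz, with step sizes `γ k ∈ [γmin, γmax] ⊆ ]0, 1/L[` and inertial
parameters `a k i, b k i ∈ ]-1, 2]`. The bound `γmax < 1/L` is written `γmax * L < 1`, so that
`1/0` is read as `+∞`. -/
structure IsMiFBSequence (R : EuclideanSpace ℝ (Fin n) → EReal)
    (F : EuclideanSpace ℝ (Fin n) → ℝ) (L : ℝ) (s : ℕ) (γmin γmax : ℝ) (γ : ℕ → ℝ)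
    (a b : ℕ → Fin s → ℝ) (x : ℕ → EuclideanSpace ℝ (Fin n)) : Prop where
  one_le_s : 1 ≤ s
  γmin_pos : 0 < γmin
  γmin_le : ∀ k, γmin ≤ γ k
  le_γmax : ∀ k, γ k ≤ γmax
  γmax_lt : γmax * L < 1
  a_mem : ∀ k i, a k i ∈ Set.Ioc (-1 : ℝ) 2
  b_mem : ∀ k i, b k i ∈ Set.Ioc (-1 : ℝ) 2
  step : ∀ k, x (k + 1) ∈
    prox (γ k) R (extrapolate x (a k) k - γ k • gradient F (extrapolate x (b k) k))

/-- `β_k = (1 - γ_k L - μ - ν γ_k) / (2 γ_k)`. -/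
def betaCoeff (L μ ν : ℝ) (γ : ℕ → ℝ) (k : ℕ) : ℝ :=
  (1 - γ k * L - μ - ν * γ k) / (2 * γ k)

/-- `α_{k,i} = s a_{i,k}² / (2 γ_k μ) + s b_{i,k}² L² / (2 ν)`. -/
def alphaCoeff (L μ ν : ℝ) {s : ℕ} (γ : ℕ → ℝ) (a b : ℕ → Fin s → ℝ) (k : ℕ) (i : Fin s) : ℝ :=
  s * a k i ^ 2 / (2 * γ k * μ) + s * b k i ^ 2 * L ^ 2 / (2 * ν)

/-- `δ = liminf_k β_k - ∑_i limsup_k α_{k,i}`. These real limits are of bounded sequences when the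
parameters are those of `IsMiFBSequence`. -/
def deltaCoeff (L μ ν : ℝ) {s : ℕ} (γ : ℕ → ℝ) (a b : ℕ → Fin s → ℝ) : ℝ :=
  liminf (fun k => betaCoeff L μ ν γ k) atTop -
    ∑ i : Fin s, limsup (fun k => alphaCoeff L μ ν γ a b k i) atTop

end Algorithm

end MiFB

end

/-!
The theorem is an instance of the identification principle for partly smooth functions
(`MiFB.IsPartlySmoothAt.eventually_mem`): if `x k → x₀` with `J (x k) → J x₀`, and subgradients
`v k ∈ ∂J (x k)` converge to a point `v₀` of the relative interior of `∂J x₀` at which `J` is partly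
smooth relative to `M`, then `x k ∈ M` eventually.

To prove it, suppose that `x k ∉ M` along a subsequence, and let `p k` be a nearest point of `M`. By
the Lagrange multiplier rule `x k - p k` is normal to `M` at `p k`, and by smoothness of `M` the
normalized displacements accumulate at a unit vector `d` normal to `M` at `x₀`
(`MiFB.exists_subseq_tendsto_normal`). Sharpness says that `d` is parallel to `∂J x₀`, so
`v₀ + t • d ∈ ∂J x₀` for small `t > 0`, and continuity of `∂J` along `M` gives `w k ∈ ∂J (p k)`
with `w k → v₀ + t • d`. The sum of the two prox-regularity inequalities for `(x k, v k)` and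
`(p k, w k)` reads `⟪w k - v k, x k - p k⟫ ≤ ‖x k - p k‖² / r`; after division by `‖x k - p k‖` the
limit is `t ≤ 0`, a contradiction.

For the iterates of the algorithm, the optimality condition of the proximal step yields a
subgradient of `R` at `x (k + 1)`. Since the step sizes are bounded away from `0` and the inertial
coefficients are bounded, these subgradients tend to `-∇F(x⋆)`
(`MiFB.IsMiFBSequence.tendsto_stepSubgradient`), and comparing the step with `x⋆` gives
`R (x k) → R x⋆` (`MiFB.IsMiFBSequence.tendsto_apply`).
-/

namespace MiFB

/-! ### Normal directions of a submanifold -/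

section Normals

variable {E F : Type*} [NormedAddCommGroup E] [InnerProductSpace ℝ E]
  [NormedAddCommGroup F] [NormedSpace ℝ F]

/-- The displacement from a nearest point `p` of a level set to `y` is normal to the level set:
since `A` is onto, the Lagrange multiplier of the squared distance does not vanish. -/
lemma exists_multiplier_of_isMinOn_dist [CompleteSpace E] [FiniteDimensional ℝ F]
    {G : E → F} {A : E →L[ℝ] F} {p y : E} (hG : HasStrictFDerivAt G A p) (hA : Function.Surjective A)
    (hmin : ∀ᶠ u in 𝓝 p, G u = G p → ‖p - y‖ ≤ ‖u - y‖) :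
    ∃ l : F →L[ℝ] ℝ, ∀ h, inner ℝ (y - p) h = l (A h) := by
  have : CompleteSpace F := FiniteDimensional.complete ℝ F
  have hext : IsLocalExtrOn (fun u => ‖u - y‖ ^ 2) {u | G u = G p} p := by
    refine Or.inl ?_
    filter_upwards [mem_nhdsWithin_of_mem_nhds hmin, self_mem_nhdsWithin] with u hu hu'
    exact pow_le_pow_left₀ (norm_nonneg _) (hu hu') 2
  have hf : HasStrictFDerivAt (fun u : E => ‖u - y‖ ^ 2) (2 • innerSL ℝ (p - y)) p := by
    have h := (hasStrictFDerivAt_norm_sq (p - y)).comp p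
      ((hasStrictFDerivAt_id (𝕜 := ℝ) p).sub_const y)
    exact h
  obtain ⟨m, c, hmc, h⟩ := hext.exists_linear_map_of_hasStrictFDerivAt hG hf
  have hc : c ≠ 0 := by
    rintro rfl
    refine hmc (Prod.ext (LinearMap.ext fun w => ?_) rfl)
    obtain ⟨v, rfl⟩ := hA w
    simpa using h v
  refine ⟨LinearMap.toContinuousLinearMap ((2 * c)⁻¹ • m), fun v => ?_⟩
  have hv := h v
  simp only [two_smul, add_apply, innerSL_apply_apply, smul_eq_mul] at hv
  have e : inner ℝ (y - p) v = - inner ℝ (p - y) v := by rw [← inner_neg_left, neg_sub]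
  have : m (A v) = 2 * c * inner ℝ (y - p) v := by rw [e]; linarith
  simp [this]
  field_simp

/-- If `B` is almost a right inverse of `A`, then a multiplier `l` with `⟪e, ·⟫ = l ∘ A` satisfies
`‖l‖ ≤ 2 ‖B‖ ‖e‖`, which controls `⟪e, h⟫` by `‖A h‖`. -/
lemma abs_inner_le_of_multiplier {A : E →L[ℝ] F} {B : F →L[ℝ] E} {l : F →L[ℝ] ℝ} {e : E}
    (hAB : ‖A.comp B - ContinuousLinearMap.id ℝ F‖ ≤ 1 / 2)
    (hl : ∀ h, inner ℝ e h = l (A h)) (h : E) :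
    |inner ℝ e h| ≤ 2 * (‖e‖ * ‖B‖) * ‖A h‖ := by
  have hb : ‖l‖ ≤ ‖e‖ * ‖B‖ + ‖l‖ * (1 / 2) := by
    refine l.opNorm_le_bound (by positivity) fun w => ?_
    have h1 : l w = inner ℝ e (B w) - l ((A.comp B - ContinuousLinearMap.id ℝ F) w) := by
      simp [hl]
    have h2 : ‖inner ℝ e (B w)‖ ≤ ‖e‖ * (‖B‖ * ‖w‖) :=
      (norm_inner_le_norm _ _).trans (by gcongr; exact B.le_opNorm w)
    have h3 : ‖l ((A.comp B - ContinuousLinearMap.id ℝ F) w)‖ ≤ ‖l‖ * (1 / 2 * ‖w‖) :=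
      (l.le_opNorm _).trans (by
        gcongr
        exact (ContinuousLinearMap.le_opNorm _ w).trans (by gcongr))
    rw [h1]
    refine (norm_sub_le _ _).trans ?_
    linarith
  rw [hl h, ← Real.norm_eq_abs]
  exact (l.le_opNorm _).trans (by gcongr; linarith)

/-- Points off a `C²` submanifold that converge to one of its points `x₀` have nearest points on it,
and a subsequence of the normalized displacements converges to a unit vector normal to the
submanifold at `x₀`. -/
lemma exists_subseq_tendsto_normal [FiniteDimensional ℝ E] {M : Set E} {x₀ : E}
    (hM : IsC2SubmanifoldAround M x₀) {y : ℕ → E} (hy : Tendsto y atTop (𝓝 x₀))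
    (hyM : ∀ k, y k ∉ M) :
    ∃ (p : ℕ → E) (d : E) (θ : ℕ → ℕ), StrictMono θ ∧ (∀ k, p k ∈ M) ∧
      Tendsto p atTop (𝓝 x₀) ∧
      Tendsto (fun k => ‖y (θ k) - p (θ k)‖⁻¹ • (y (θ k) - p (θ k))) atTop (𝓝 d) ∧
      ‖d‖ = 1 ∧ ∀ h ∈ tangentSpaceAt M x₀, inner ℝ d h = 0 := by
  have : CompleteSpace E := FiniteDimensional.complete ℝ E
  obtain ⟨hx₀, m, G, U, hUo, hxU, hG, hsurj, hMU⟩ := hM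
  obtain ⟨ρ, hρ, hρU⟩ := Metric.nhds_basis_closedBall.mem_iff.1 (hUo.mem_nhds hxU)
  have hGx : G x₀ = 0 := by
    have : x₀ ∈ {y ∈ U | G y = 0} := hMU ▸ ⟨hx₀, hxU⟩
    exact this.2
  have hstrict : ∀ z ∈ U, HasStrictFDerivAt G (fderiv ℝ G z) z := fun z hz =>
    (hG.contDiffAt (hUo.mem_nhds hz)).hasStrictFDerivAt (by norm_num)
  -- The part of `M` in a small closed ball is compact, so nearest points in it exist.
  set K : Set E := Metric.closedBall x₀ ρ ∩ G ⁻¹' {0} with hK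
  have hKM : K ⊆ M := fun z hz => by
    have : z ∈ M ∩ U := hMU ▸ ⟨hρU hz.1, hz.2⟩
    exact this.1
  have hKc : IsCompact K := by
    refine (isCompact_closedBall x₀ ρ).of_isClosed_subset ?_ Set.inter_subset_left
    exact (hG.continuousOn.mono hρU).preimage_isClosed_of_isClosed Metric.isClosed_closedBall
      isClosed_singleton
  have hxK : x₀ ∈ K := ⟨Metric.mem_closedBall_self hρ.le, hGx⟩
  have hnear : ∀ k, ∃ p ∈ K, ∀ u ∈ K, ‖p - y k‖ ≤ ‖u - y k‖ := fun k => by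
    obtain ⟨p, hp, hmin⟩ := hKc.exists_isMinOn (f := fun u => ‖u - y k‖) ⟨x₀, hxK⟩ (by fun_prop)
    exact ⟨p, hp, fun u hu => hmin hu⟩
  choose p hpK hpmin using hnear
  have hp : Tendsto p atTop (𝓝 x₀) := by
    rw [tendsto_iff_norm_sub_tendsto_zero] at hy ⊢
    refine squeeze_zero (fun _ => norm_nonneg _) (fun k => ?_) (by simpa using hy.const_mul 2)
    have h1 := hpmin k x₀ hxK
    have h2 := norm_add_le (p k - y k) (y k - x₀)
    rw [sub_add_sub_cancel] at h2
    rw [norm_sub_rev x₀] at h1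
    linarith
  have hne : ∀ k, y k - p k ≠ 0 := fun k h =>
    hyM k (by rw [sub_eq_zero.1 h]; exact hKM (hpK k))
  set e : ℕ → E := fun k => ‖y k - p k‖⁻¹ • (y k - p k) with he
  have hen : ∀ k, ‖e k‖ = 1 := fun k => by
    rw [he]; simp only [norm_smul, norm_inv, norm_norm]
    exact inv_mul_cancel₀ (norm_ne_zero_iff.2 (hne k))
  obtain ⟨d, hd, θ, hθ, hlim⟩ := (isCompact_sphere (0 : E) 1).tendsto_subseq
    (x := e) (fun k => by simp [hen k])
  refine ⟨p, d, θ, hθ, fun k => hKM (hpK k), hp, hlim, by simpa using hd, ?_⟩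
  rintro h ⟨c, hc, hc0, hcM, rfl⟩
  -- Velocities of curves in `M` are in the kernel of the derivative of the defining map.
  have hker : fderiv ℝ G x₀ (deriv c 0) = 0 := by
    have hc' : HasDerivAt c (deriv c 0) 0 :=
      (hc.differentiableAt (by norm_num)).hasDerivAt
    have h1 : HasDerivAt (G ∘ c) (fderiv ℝ G x₀ (deriv c 0)) 0 :=
      HasFDerivAt.comp_hasDerivAt (0 : ℝ) (by rw [hc0]; exact (hstrict x₀ hxU).hasFDerivAt) hc'
    have h2 : G ∘ c =ᶠ[𝓝 0] fun _ => 0 := by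
      have hcU : ∀ᶠ t in 𝓝 (0 : ℝ), c t ∈ U :=
        hc'.continuousAt.eventually (by rw [hc0]; exact hUo.mem_nhds hxU)
      filter_upwards [hcM, hcU] with t h1 h2
      have : c t ∈ {y ∈ U | G y = 0} := hMU ▸ ⟨h1, h2⟩
      exact this.2
    exact h1.unique ((hasDerivAt_const (0 : ℝ) (0 : EuclideanSpace ℝ (Fin m))).congr_of_eventuallyEq
      h2)
  obtain ⟨B, hB⟩ := (fderiv ℝ G x₀).exists_rightInverse_of_surjective
    (LinearMap.range_eq_top.2 (hsurj x₀ hxU))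
  have hA : Tendsto (fun k => fderiv ℝ G (p k)) atTop (𝓝 (fderiv ℝ G x₀)) :=
    ((hG.continuousOn_fderiv_of_isOpen hUo (by norm_num)).continuousAt
      (hUo.mem_nhds hxU)).tendsto.comp hp
  have hAB : ∀ᶠ k in atTop,
      ‖(fderiv ℝ G (p k)).comp B - ContinuousLinearMap.id ℝ (EuclideanSpace ℝ (Fin m))‖
        ≤ 1 / 2 := by
    have h1 : Tendsto (fun k => (fderiv ℝ G (p k)).comp B) atTop
        (𝓝 ((fderiv ℝ G x₀).comp B)) :=
      ((ContinuousLinearMap.compL ℝ (EuclideanSpace ℝ (Fin m)) E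
        (EuclideanSpace ℝ (Fin m))).flip B).continuous.continuousAt.tendsto.comp hA
    rw [hB, tendsto_iff_norm_sub_tendsto_zero] at h1
    exact h1.eventually_le_const (by norm_num)
  have hbound : ∀ᶠ k in atTop,
      |inner ℝ (e k) (deriv c 0)| ≤ 2 * (1 * ‖B‖) * ‖fderiv ℝ G (p k) (deriv c 0)‖ := by
    have hball : ∀ᶠ k in atTop, p k ∈ Metric.ball x₀ ρ :=
      hp.eventually (Metric.ball_mem_nhds x₀ hρ)
    filter_upwards [hAB, hball] with k hk hpk
    have hpU : p k ∈ U := hρU (Metric.ball_subset_closedBall hpk)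
    obtain ⟨l, hl⟩ := exists_multiplier_of_isMinOn_dist (y := y k) (hstrict _ hpU) (hsurj _ hpU) (by
      filter_upwards [Metric.isOpen_ball.mem_nhds hpk] with u hu hGu
      exact hpmin k u ⟨Metric.ball_subset_closedBall hu, by
        rw [Set.mem_preimage, hGu]; exact (hpK k).2⟩)
    rw [← hen k]
    refine abs_inner_le_of_multiplier (l := ‖y k - p k‖⁻¹ • l) hk (fun v => ?_) _
    simp [he, inner_smul_left, hl]
  have hzero : Tendsto (fun k => inner ℝ (e k) (deriv c 0)) atTop (𝓝 0) := by
    refine squeeze_zero_norm' hbound ?_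
    have h1 : Tendsto (fun k => fderiv ℝ G (p k) (deriv c 0)) atTop (𝓝 0) := by
      rw [← hker]
      exact (ContinuousLinearMap.apply ℝ (EuclideanSpace ℝ (Fin m))
        (deriv c 0)).continuous.continuousAt.tendsto.comp hA
    simpa using h1.norm.const_mul (2 * (1 * ‖B‖))
  exact tendsto_nhds_unique (hlim.inner tendsto_const_nhds) (hzero.comp hθ.tendsto_atTop)

end Normals

/-! ### Identification of the active manifold -/

section Identification

variable {E : Type*} [NormedAddCommGroup E] [InnerProductSpace ℝ E]

/-- From a relative interior point one can move a little in every direction parallel to the set. -/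
lemma eventually_add_smul_mem_of_mem_intrinsicInterior {S : Set E} {v d : E}
    (hv : v ∈ intrinsicInterior ℝ S) (hd : d ∈ vectorSpan ℝ S) :
    ∀ᶠ t in 𝓝 (0 : ℝ), v + t • d ∈ S := by
  obtain ⟨w, hw, rfl⟩ := hv
  have hmem : ∀ t : ℝ, (w : E) + t • d ∈ affineSpan ℝ S := fun t => by
    have := AffineSubspace.vadd_mem_of_mem_direction (s := affineSpan ℝ S)
      (by rw [direction_affineSpan]; exact Submodule.smul_mem _ t hd) w.2
    simpa [add_comm] using this
  have hcont : Continuous fun t : ℝ => (⟨(w : E) + t • d, hmem t⟩ : affineSpan ℝ S) := by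
    fun_prop
  have h0 : (⟨(w : E) + (0 : ℝ) • d, hmem 0⟩ : affineSpan ℝ S) = w := by ext; simp
  have h1 := hcont.tendsto 0
  rw [h0] at h1
  exact h1.eventually (mem_interior_iff_mem_nhds.1 hw)

/-- Identification for partly smooth functions: if `x k → x₀` with `J (x k) → J x₀` and subgradients
`v k ∈ ∂J (x k)` tend to a relative interior point of `∂J x₀`, then `x k` lies on the manifold
eventually. Otherwise, tilt `v₀` by a small multiple of a limiting normal direction `d`; inner
semicontinuity lifts the tilted subgradient to the nearest points `p k ∈ M`, and hypomonotonicity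
of `∂J` (the sum of two prox-regularity inequalities) is violated in the limit along
`x k - p k`. -/
theorem IsPartlySmoothAt.eventually_mem [FiniteDimensional ℝ E] {J : E → EReal} {x₀ v₀ : E}
    {M : Set E} (hJ : ∀ x, J x ≠ ⊥) (hPS : IsPartlySmoothAt J x₀ v₀ M)
    (hri : v₀ ∈ intrinsicInterior ℝ (subdiff J x₀)) {x v : ℕ → E}
    (hx : Tendsto x atTop (𝓝 x₀)) (hJx : Tendsto (fun k => J (x k)) atTop (𝓝 (J x₀)))
    (hv : Tendsto v atTop (𝓝 v₀)) (hmem : ∀ k, v k ∈ subdiff J (x k)) :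
    ∀ᶠ k in atTop, x k ∈ M := by
  have : CompleteSpace E := FiniteDimensional.complete ℝ E
  by_contra hcon
  obtain ⟨ψ, hψ, hψM⟩ := extraction_of_frequently_atTop (not_eventually.1 hcon)
  obtain ⟨p, d, θ, hθ, hpM, hp, hd, hd1, hdT⟩ := exists_subseq_tendsto_normal hPS.submanifold
    (hx.comp hψ.tendsto_atTop) hψM
  have hdspan : d ∈ vectorSpan ℝ (subdiff J x₀) := by
    rw [← Submodule.orthogonal_orthogonal (vectorSpan ℝ (subdiff J x₀)),
      Submodule.mem_orthogonal']
    intro h hh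
    exact hdT h (by rw [hPS.sharpness]; exact hh)
  obtain ⟨-, r, hr, ε, hε, hprox⟩ := hPS.proxRegularity
  obtain ⟨t, ⟨htS, htε⟩, ht⟩ : ∃ t : ℝ, (v₀ + t • d ∈ subdiff J x₀ ∧ t < ε) ∧ 0 < t :=
    (((eventually_add_smul_mem_of_mem_intrinsicInterior hri hdspan).filter_mono
      nhdsWithin_le_nhds).and ((eventually_lt_nhds hε).filter_mono nhdsWithin_le_nhds)
      |>.and self_mem_nhdsWithin : ∀ᶠ t in 𝓝[>] (0 : ℝ), _).exists
  -- All sequences are now taken along the subsequence `σ`.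
  set σ := ψ ∘ θ
  have hσ : Tendsto σ atTop atTop := hψ.tendsto_atTop.comp hθ.tendsto_atTop
  replace hx := hx.comp hσ
  replace hJx := hJx.comp hσ
  replace hv := hv.comp hσ
  replace hp := hp.comp hθ.tendsto_atTop
  have hpW : Tendsto (p ∘ θ) atTop (𝓝[M] x₀) :=
    tendsto_nhdsWithin_iff.2 ⟨hp, Eventually.of_forall fun k => hpM _⟩
  obtain ⟨g, hg, hgJ⟩ := hPS.smoothness
  have hx₀ : J x₀ = g x₀ := hgJ.self_of_nhdsWithin hPS.submanifold.1
  -- The tilted subgradient lifts to `p (θ k)` up to an error `δ`; with `δ < ε - t` the lift stays in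
  -- the `ε`-ball around `v₀` where prox-regularity applies.
  have key : ∀ δ : ℝ, 0 < δ → δ < ε - t → ∀ᶠ k in atTop,
      inner ℝ (v₀ + t • d - v (σ k)) (‖x (σ k) - p (θ k)‖⁻¹ • (x (σ k) - p (θ k)))
        ≤ δ + 1 / r * ‖x (σ k) - p (θ k)‖ := by
    intro δ hδ hδε
    have e1 : ∀ᶠ k in atTop, ‖x (σ k) - x₀‖ < ε :=
      (tendsto_iff_norm_sub_tendsto_zero.1 hx).eventually_lt_const hε
    have e2 : ∀ᶠ k in atTop, ‖p (θ k) - x₀‖ < ε :=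
      (tendsto_iff_norm_sub_tendsto_zero.1 hp).eventually_lt_const hε
    have e3 : ∀ᶠ k in atTop, ‖v (σ k) - v₀‖ < ε :=
      (tendsto_iff_norm_sub_tendsto_zero.1 hv).eventually_lt_const hε
    have e4 : ∀ᶠ k in atTop, |(J (x (σ k))).toReal - (J x₀).toReal| < ε := by
      have h1 := (EReal.tendsto_toReal (by simp [hx₀]) (hJ x₀)).comp hJx
      have h2 := tendsto_iff_norm_sub_tendsto_zero.1 h1
      exact h2.eventually_lt_const hε
    have e5 : ∀ᶠ k in atTop, J (p (θ k)) = g (p (θ k)) := hpW.eventually hgJ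
    have e6 : ∀ᶠ k in atTop, |g (p (θ k)) - g x₀| < ε := by
      have h1 := hg.continuousAt.tendsto.comp hp
      exact (tendsto_iff_norm_sub_tendsto_zero.1 h1).eventually_lt_const hε
    have e7 := hpW.eventually (hPS.continuity.2 _ htS δ hδ)
    filter_upwards [e1, e2, e3, e4, e5, e6, e7] with k h1 h2 h3 h4 h5 h6 h7
    obtain ⟨w, hw, hwδ⟩ := h7
    have hwε : ‖w - v₀‖ < ε := by
      have : w - v₀ = (w - (v₀ + t • d)) + t • d := by abel
      rw [this]
      refine (norm_add_le _ _).trans_lt ?_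
      rw [norm_smul, hd1, Real.norm_of_nonneg ht.le]
      linarith
    have i1 := hprox (x (σ k)) (p (θ k)) (v (σ k)) h1 h2 h4 (hmem _) h3
    have i2 := hprox (p (θ k)) (x (σ k)) w h2 h1 (by rw [h5, hx₀]; exact h6) hw hwε
    have hfin : J (x (σ k)) = (J (x (σ k))).toReal :=
      (EReal.coe_toReal (hmem (σ k)).1.ne (hJ _)).symm
    rw [hfin, h5] at i1 i2
    norm_cast at i1 i2
    set q := x (σ k) - p (θ k) with hq
    have hqpos : 0 < ‖q‖ := norm_pos_iff.2 fun h => hψM (θ k) (by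
      have : x (ψ (θ k)) = p (θ k) := sub_eq_zero.1 h
      rw [this]; exact hpM _)
    have hsum : inner ℝ (w - v (σ k)) q ≤ 1 / r * ‖q‖ ^ 2 := by
      have hrev : p (θ k) - x (σ k) = -q := by rw [hq, neg_sub]
      rw [hrev, inner_neg_right] at i1
      rw [hrev, norm_neg] at i2
      rw [inner_sub_left]
      have : 1 / r * ‖q‖ ^ 2 = 1 / (2 * r) * ‖q‖ ^ 2 + 1 / (2 * r) * ‖q‖ ^ 2 := by
        field_simp; ring
      linarith
    have herr : inner ℝ (v₀ + t • d - w) q ≤ δ * ‖q‖ :=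
      (real_inner_le_norm _ _).trans (by
        gcongr; rw [norm_sub_rev]; exact hwδ.le)
    have htot : inner ℝ (v₀ + t • d - v (σ k)) q ≤ (δ + 1 / r * ‖q‖) * ‖q‖ := by
      rw [← sub_add_sub_cancel _ w, inner_add_left]
      linarith
    rw [inner_smul_right, inv_mul_le_iff₀ hqpos]
    linarith
  -- The left side tends to `⟪t • d, d⟫ = t`, the right side to `δ`, which may be less than `t`.
  obtain ⟨δ, hδ, hδt⟩ := exists_between (lt_min ht (sub_pos.2 htε))
  have hL : Tendsto (fun k => inner ℝ (v₀ + t • d - v (σ k))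
      (‖x (σ k) - p (θ k)‖⁻¹ • (x (σ k) - p (θ k)))) atTop
      (𝓝 (inner ℝ (v₀ + t • d - v₀) d)) := (tendsto_const_nhds.sub hv).inner hd
  have hR : Tendsto (fun k => δ + 1 / r * ‖x (σ k) - p (θ k)‖) atTop (𝓝 δ) := by
    have := ((hx.sub hp).norm.const_mul (1 / r)).const_add δ
    simpa using this
  have := le_of_tendsto_of_tendsto hL hR (key δ hδ (hδt.trans_le (min_le_right _ _)))
  rw [add_sub_cancel_left, inner_smul_left, real_inner_self_eq_norm_sq, hd1] at this
  simp at this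
  exact absurd (hδt.trans_le (min_le_left _ _)) (not_lt.2 this)

end Identification

/-! ### Proximal points -/

section Prox

variable {E : Type*} [NormedAddCommGroup E] [InnerProductSpace ℝ E]

lemma frechetSubdiff_subset_subdiff (J : E → EReal) (x : E) : frechetSubdiff J x ⊆ subdiff J x :=
  fun v hv => ⟨hv.1, fun _ => x, fun _ => v, tendsto_const_nhds, tendsto_const_nhds, fun _ => hv,
    tendsto_const_nhds⟩

lemma mem_dom_of_mem_prox {J : E → EReal} (hJ : IsProper J) {γ : ℝ} (hγ : 0 < γ) {z p : E}
    (hp : p ∈ prox γ J z) : p ∈ dom J := by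
  obtain ⟨u, hu⟩ := hJ.2
  change J p < ⊤
  refine lt_top_iff_ne_top.2 fun h => ?_
  have h1 := hp u
  rw [h, EReal.coe_mul_top_of_pos hγ, EReal.coe_add_top, ← EReal.coe_toReal hu.ne (hJ.1 u),
    ← EReal.coe_mul, ← EReal.coe_add, top_le_iff] at h1
  exact EReal.coe_ne_top _ h1

/-- The minimality of a proximal point `p` of `z`, with the square expanded around `p`: the vector
`γ⁻¹ (z - p)` supports `J` at `p` globally, up to the quadratic `‖u - p‖² / (2γ)`. -/
lemma quadratic_minorant_of_mem_prox {J : E → EReal} (hJ : IsProper J) {γ : ℝ} (hγ : 0 < γ)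
    {z p : E} (hp : p ∈ prox γ J z) (u : E) :
    J p + ((inner ℝ (γ⁻¹ • (z - p)) (u - p) - 1 / (2 * γ) * ‖u - p‖ ^ 2 : ℝ) : EReal) ≤ J u := by
  by_cases hu : J u = ⊤
  · simp [hu]
  have h1 := hp u
  rw [← EReal.coe_toReal hu (hJ.1 u),
    ← EReal.coe_toReal (mem_dom_of_mem_prox hJ hγ hp).ne (hJ.1 p)] at h1 ⊢
  norm_cast at h1 ⊢
  have h2 : ‖u - z‖ ^ 2 = ‖u - p‖ ^ 2 - 2 * inner ℝ (z - p) (u - p) + ‖p - z‖ ^ 2 := by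
    rw [← sub_sub_sub_cancel_right u z p, norm_sub_sq_real, real_inner_comm (z - p),
      norm_sub_rev z p]
  rw [h2] at h1
  have h3 : γ * (inner ℝ (γ⁻¹ • (z - p)) (u - p) - 1 / (2 * γ) * ‖u - p‖ ^ 2)
      = inner ℝ (z - p) (u - p) - 1 / 2 * ‖u - p‖ ^ 2 := by
    rw [real_inner_smul_left]; field_simp
  refine le_of_mul_le_mul_left ?_ hγ
  rw [mul_add, h3]
  linarith

/-- Fermat's rule for the proximity operator. -/
lemma smul_sub_mem_frechetSubdiff_of_mem_prox {J : E → EReal} (hJ : IsProper J) {γ : ℝ}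
    (hγ : 0 < γ) {z p : E} (hp : p ∈ prox γ J z) : γ⁻¹ • (z - p) ∈ frechetSubdiff J p := by
  have hpd := mem_dom_of_mem_prox hJ hγ hp
  refine ⟨hpd, ?_⟩
  -- On a one-point space the punctured neighbourhood filter is trivial and the `liminf` is `⊤`.
  rcases eq_or_neBot (𝓝[≠] p) with hbot | hne
  · simp [hbot]
  have hlim : Tendsto (fun u => ((-(1 / (2 * γ) * ‖p - u‖) : ℝ) : EReal)) (𝓝[≠] p)
      (𝓝 ((0 : ℝ) : EReal)) := by
    refine (continuous_coe_real_ereal.tendsto 0).comp (Tendsto.mono_left ?_ nhdsWithin_le_nhds)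
    have : Continuous fun u => -(1 / (2 * γ) * ‖p - u‖) := by fun_prop
    simpa using this.tendsto p
  rw [← EReal.coe_zero, ← hlim.liminf_eq]
  refine liminf_le_liminf ?_
  filter_upwards [self_mem_nhdsWithin] with u hu
  have hpos : 0 < ‖p - u‖ := norm_pos_iff.2 (sub_ne_zero.2 (Ne.symm hu))
  rw [EReal.le_div_iff_mul_le (by exact_mod_cast hpos) (EReal.coe_ne_top _)]
  have h1 := quadratic_minorant_of_mem_prox hJ hγ hp u
  rw [← EReal.coe_toReal hpd.ne (hJ.1 p)] at h1 ⊢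
  by_cases hu : J u = ⊤
  · simp [hu, sub_eq_add_neg, ← EReal.coe_neg]
  rw [← EReal.coe_toReal hu (hJ.1 u)] at h1 ⊢
  norm_cast at h1 ⊢
  rw [norm_sub_rev u p] at h1
  linarith

end Prox

/-! ### Subgradients along the iterates -/

section Algorithm

variable {n s : ℕ}

lemma tendsto_extrapolate {x : ℕ → EuclideanSpace ℝ (Fin n)} {x₀ : EuclideanSpace ℝ (Fin n)}
    (hx : Tendsto x atTop (𝓝 x₀)) {c : ℕ → Fin s → ℝ} {C : ℝ} (hc : ∀ k i, |c k i| ≤ C) :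
    Tendsto (fun k => extrapolate x (c k) k) atTop (𝓝 x₀) := by
  have hterm : ∀ i : Fin s,
      Tendsto (fun k => c k i • (x (k - (i : ℕ)) - x (k - (i : ℕ) - 1))) atTop (𝓝 0) := fun i => by
    have h1 : Tendsto (fun k => x (k - (i : ℕ))) atTop (𝓝 x₀) := hx.comp (tendsto_sub_atTop_nat _)
    have h2 : Tendsto (fun k => x (k - (i : ℕ) - 1)) atTop (𝓝 x₀) :=
      hx.comp ((tendsto_sub_atTop_nat 1).comp (tendsto_sub_atTop_nat _))
    refine squeeze_zero_norm (fun k => ?_) (by simpa using (h1.sub h2).norm.const_mul C)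
    rw [norm_smul]
    gcongr
    exact hc k i
  simpa [extrapolate] using hx.add (tendsto_finsetSum Finset.univ fun i _ => hterm i)

/-- The subgradient of `R` at `x (k + 1)` that the optimality condition of the `k`-th step
provides. -/
noncomputable def stepSubgradient (F : EuclideanSpace ℝ (Fin n) → ℝ) (γ : ℕ → ℝ)
    (a b : ℕ → Fin s → ℝ) (x : ℕ → EuclideanSpace ℝ (Fin n)) (k : ℕ) : EuclideanSpace ℝ (Fin n) :=
  (γ k)⁻¹ • (extrapolate x (a k) k - γ k • gradient F (extrapolate x (b k) k) - x (k + 1))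

variable {R : EuclideanSpace ℝ (Fin n) → EReal} {F : EuclideanSpace ℝ (Fin n) → ℝ} {L γmin γmax : ℝ}
  {γ : ℕ → ℝ} {a b : ℕ → Fin s → ℝ} {x : ℕ → EuclideanSpace ℝ (Fin n)}
  {x₀ : EuclideanSpace ℝ (Fin n)}

lemma IsMiFBSequence.γ_pos (h : IsMiFBSequence R F L s γmin γmax γ a b x) (k : ℕ) : 0 < γ k :=
  h.γmin_pos.trans_le (h.γmin_le k)

lemma IsMiFBSequence.tendsto_stepSubgradient (h : IsMiFBSequence R F L s γmin γmax γ a b x)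
    (hF : Continuous (gradient F)) (hx : Tendsto x atTop (𝓝 x₀)) :
    Tendsto (stepSubgradient F γ a b x) atTop (𝓝 (-gradient F x₀)) := by
  have habs : ∀ t ∈ Set.Ioc (-1 : ℝ) 2, |t| ≤ 2 := fun t ht =>
    abs_le.2 ⟨by linarith [ht.1], ht.2⟩
  have ha := tendsto_extrapolate hx fun k i => habs _ (h.a_mem k i)
  have hb := tendsto_extrapolate hx fun k i => habs _ (h.b_mem k i)
  have h1 : Tendsto (fun k => (γ k)⁻¹ • (extrapolate x (a k) k - x (k + 1))) atTop (𝓝 0) := by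
    refine squeeze_zero_norm (fun k => ?_) (by
      simpa using (ha.sub ((tendsto_add_atTop_iff_nat 1).2 hx)).norm.const_mul γmin⁻¹)
    rw [norm_smul, Real.norm_of_nonneg (inv_nonneg.2 (h.γ_pos k).le)]
    gcongr
    exacts [h.γmin_pos, h.γmin_le k]
  have h2 := h1.sub ((hF.tendsto x₀).comp hb)
  rw [zero_sub] at h2
  refine h2.congr fun k => ?_
  rw [stepSubgradient, sub_right_comm, smul_sub _ (_ - _), inv_smul_smul₀ (h.γ_pos k).ne']
  rfl

/-- The iterates converge `R`-attentively: lower semicontinuity gives the lower bound, comparison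
of the proximal step with the limit point the upper bound. -/
lemma IsMiFBSequence.tendsto_apply (h : IsMiFBSequence R F L s γmin γmax γ a b x)
    (hR : IsProper R) (hlsc : LowerSemicontinuous R) (hF : Continuous (gradient F))
    (hx : Tendsto x atTop (𝓝 x₀)) (hx₀ : x₀ ∈ dom R) :
    Tendsto (fun k => R (x (k + 1))) atTop (𝓝 (R x₀)) := by
  have hx1 := (tendsto_add_atTop_iff_nat 1).2 hx
  have hsub : Tendsto (fun k => x₀ - x (k + 1)) atTop (𝓝 0) := by
    simpa using hx1.const_sub x₀
  have hc : Tendsto (fun k => inner ℝ (stepSubgradient F γ a b x k) (x₀ - x (k + 1))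
      - 1 / (2 * γ k) * ‖x₀ - x (k + 1)‖ ^ 2) atTop (𝓝 0) := by
    have h1 := (h.tendsto_stepSubgradient hF hx).inner (𝕜 := ℝ) hsub
    have h2 : Tendsto (fun k => 1 / (2 * γ k) * ‖x₀ - x (k + 1)‖ ^ 2) atTop (𝓝 0) := by
      refine squeeze_zero (fun k => ?_) (fun k => ?_) (by
        simpa only [norm_zero, ne_eq, OfNat.ofNat_ne_zero, not_false_eq_true, zero_pow, mul_zero]
          using (hsub.norm.pow 2).const_mul (1 / (2 * γmin)))
      · have := h.γ_pos k
        positivity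
      · have h3 := h.γmin_pos
        have h4 := h.γmin_le k
        gcongr
    simpa using h1.sub h2
  have hle : ∀ k, R (x (k + 1)) ≤ (((R x₀).toReal
      - (inner ℝ (stepSubgradient F γ a b x k) (x₀ - x (k + 1))
        - 1 / (2 * γ k) * ‖x₀ - x (k + 1)‖ ^ 2) : ℝ) : EReal) := fun k => by
    have hq := quadratic_minorant_of_mem_prox hR (h.γ_pos k) (h.step k) x₀
    have hd := mem_dom_of_mem_prox hR (h.γ_pos k) (h.step k)
    rw [← EReal.coe_toReal hx₀.ne (hR.1 x₀), ← EReal.coe_toReal hd.ne (hR.1 _)] at hq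
    rw [← EReal.coe_toReal hd.ne (hR.1 _)]
    norm_cast at hq ⊢
    rw [stepSubgradient]
    linarith
  have hup := (continuous_coe_real_ereal.tendsto _).comp (hc.const_sub (R x₀).toReal)
  rw [sub_zero, EReal.coe_toReal hx₀.ne (hR.1 x₀)] at hup
  refine tendsto_order.2 ⟨fun t ht => hx1.eventually (hlsc x₀ t ht), fun t ht => ?_⟩
  filter_upwards [(tendsto_order.1 hup).2 t ht] with k hk using (hle k).trans_lt hk

end Algorithm

end MiFB

theorem theorem3p2 {n : ℕ}
    (R : EuclideanSpace ℝ (Fin n) → EReal) (F : EuclideanSpace ℝ (Fin n) → ℝ) (L : NNReal)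
    (hR_proper : MiFB.IsProper R) (hR_lsc : LowerSemicontinuous R)
    (hR_bdd : MiFB.IsBoundedBelow R)
    (hF_diff : Differentiable ℝ F) (hF_lip : LipschitzWith L (gradient F))
    (hΦ_KL : MiFB.IsKLFunction (MiFB.objective R F))
    (hΦ_bdd : MiFB.IsBoundedBelow (MiFB.objective R F))
    {s : ℕ} (γmin γmax : ℝ) (γ : ℕ → ℝ) (a b : ℕ → Fin s → ℝ)
    (x : ℕ → EuclideanSpace ℝ (Fin n))
    (hx : MiFB.IsMiFBSequence R F L s γmin γmax γ a b x)
    (μ ν : ℝ) (hμ : 0 < μ) (hν : 0 < ν)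
    (hδ : 0 < MiFB.deltaCoeff (L : ℝ) μ ν γ a b)
    (xstar : EuclideanSpace ℝ (Fin n))
    (hx_lim : Filter.Tendsto x Filter.atTop (nhds xstar))
    (hx_crit : xstar ∈ MiFB.crit (MiFB.objective R F))
    (M : Set (EuclideanSpace ℝ (Fin n)))
    (hPSF : MiFB.IsPartlySmoothAt R xstar (-gradient F xstar) M)
    (hND : -gradient F xstar ∈ intrinsicInterior ℝ (MiFB.subdiff R xstar)) :
    ∀ᶠ k in Filter.atTop, x k ∈ M := by
  have hF : Continuous (gradient F) := hF_lip.continuous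
  have hshift : ∀ᶠ k in Filter.atTop, x (k + 1) ∈ M :=
    hPSF.eventually_mem hR_proper.1 hND ((Filter.tendsto_add_atTop_iff_nat 1).2 hx_lim)
      (hx.tendsto_apply hR_proper hR_lsc hF hx_lim hPSF.mem_subdiff.1)
      (hx.tendsto_stepSubgradient hF hx_lim) fun k =>
        MiFB.frechetSubdiff_subset_subdiff _ _
          (MiFB.smul_sub_mem_frechetSubdiff_of_mem_prox hR_proper (hx.γ_pos k) (hx.step k))
  rw [← Filter.map_add_atTop_eq_nat 1]
  exact hshift
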